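/- Let $m\ge 1$ and $i\ge 0$ be integers with $0\le i\le \lfloor 3(m-1)/2\rfloor$. Put $L=\max\left(0,\lfloor (i+2-m)/2\rfloor\right)$, $U=\lfloor i/2\rfloor$ and $h_i=\lfloor (i+2)/2\rfloor-L$ (so $h_i=U-L+1$), and let $$W=\left(\frac{m}{3m-2-2p-2q}\binom{3m-2-2p-2q}{m-1-p-q}\right)_{L\le p,q\le U},$$ where $\binom{n}{k}=0$ for $k<0$. Let $$\mathcal A_i^m=\{A_p=(p,p)\mid L\le p\le U\},\qquad \mathcal B_i^m=\{B_q=(2m-2-q,\,m-1-q)\mid L\le q\le U\}.$$ A subdiagonal NE lattice path is a lattice path in $\mathbb Z^2$ with unit North and East steps all of whose vertices $(x,y)$ satisfy $y\le x$. A path system from $\mathcal A_i^m$ to $\mathcal B_i^m$ is a family of subdiagonal NE lattice paths $P_p\colon A_p\to B_{\sigma(p)}$, $L\le p\le U$, with $\sigma$ a permutation of $\{L,\dots,U\}$; it is vertex disjoint if no two of its paths share a vertex. A lower primitive segment of a path is a segment with at least one step whose two endpoints are its only vertices on the shifted diagonal $y=x-m+1$ and all of whose vertices lie on or below that line. The flip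 of a path is obtained by reflecting each of its lower primitive segments over the shifted diagonal and keeping the rest; the flip of a path system is obtained by flipping all of its paths. A path system is doubly vertex disjoint if both it and its flip are vertex disjoint. Then the number $N(i,m)$ of doubly vertex disjoint path systems from $\mathcal A_i^m$ to $\mathcal B_i^m$ is finite and $$\det W=(-1)^{\lfloor h_i/2\rfloor}\,N(i,m).$$ Moreover, $\det W\neq 0$ if and only if $2h_i\le m$ or $i=\frac{3(m-1)}{2}$. -/

import Mathlib

/-! ### Index range, matrix, and the rank `h` -/

/-- The lower end `⌊(i + 2 - m) / 2⌋_⋆ = max (0, ⌊(i + 2 - m) / 2⌋)` of the index range.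
Truncated subtraction and floor division on `ℕ` produce exactly this value. -/
def lowIndex (i m : ℕ) : ℕ := (i + 2 - m) / 2

/-- The index set `⌊(i + 2 - m) / 2⌋_⋆ ≤ p ≤ ⌊i / 2⌋`. -/
abbrev Idx (i m : ℕ) : Type := ↥(Finset.Icc (lowIndex i m) (i / 2))

/-- `h_i = ⌊(i + 2) / 2⌋ - ⌊(i + 2 - m) / 2⌋_⋆`; the subtraction never truncates, because
`lowIndex i m ≤ (i + 2) / 2`. -/
def hNumber (i m : ℕ) : ℕ := (i + 2) / 2 - lowIndex i m

/-- The binomial coefficient with integer entries; it vanishes when the lower entry is negative. -/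
def intBinom (n k : ℤ) : ℤ := if 0 ≤ k then Ring.choose n k.toNat else 0

/-- The matrix with entries `m / (3m-2-2p-2q) * binom (3m-2-2p-2q) (m-1-p-q)`. -/
def pathCountMatrix (i m : ℕ) : Matrix (Idx i m) (Idx i m) ℚ :=
  Matrix.of fun p q =>
    (m : ℚ) / (3 * (m : ℚ) - 2 - 2 * ((p : ℕ) : ℚ) - 2 * ((q : ℕ) : ℚ)) *
      (intBinom (3 * (m : ℤ) - 2 - 2 * ((p : ℕ) : ℤ) - 2 * ((q : ℕ) : ℤ))
        ((m : ℤ) - 1 - ((p : ℕ) : ℤ) - ((q : ℕ) : ℤ)) : ℚ)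

/-! ### Subdiagonal NE lattice paths -/

/-- A North step or an East step. -/
def IsNEStep (v w : ℤ × ℤ) : Prop := w = (v.1, v.2 + 1) ∨ w = (v.1 + 1, v.2)

/-- `P` is the list of vertices of a NE lattice path from `A` to `B` all of whose vertices lie on
or below the main diagonal `y = x`. -/
def IsSubdiagonalPath (A B : ℤ × ℤ) (P : List (ℤ × ℤ)) : Prop :=
  P.head? = some A ∧ P.getLast? = some B ∧ P.IsChain IsNEStep ∧ ∀ v ∈ P, v.2 ≤ v.1

/-- The vertex `A_p = (p, p)`. -/
def rowVertex (p : ℕ) : ℤ × ℤ := ((p : ℤ), (p : ℤ))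

/-- The vertex `B_q = (2m-2-q, m-1-q)`. -/
def colVertex (m q : ℕ) : ℤ × ℤ := (2 * (m : ℤ) - 2 - (q : ℤ), (m : ℤ) - 1 - (q : ℤ))

/-! ### Primitive segments and flips -/

/-- The vertex lies on the shifted diagonal `y = x - m + 1`. -/
def OnShiftedDiagonal (m : ℕ) (v : ℤ × ℤ) : Prop := v.2 = v.1 - (m : ℤ) + 1

/-- The vertex lies on or below the shifted diagonal `y = x - m + 1`. -/
def OnOrBelowShiftedDiagonal (m : ℕ) (v : ℤ × ℤ) : Prop := v.2 ≤ v.1 - (m : ℤ) + 1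

/-- The vertices of `P` in positions `k, k+1, …, l` form a primitive segment: the two endpoints
are the only ones of these vertices that lie on the shifted diagonal. -/
def IsPrimitiveSegment (m : ℕ) (P : List (ℤ × ℤ)) (k l : ℕ) : Prop :=
  k < l ∧ l < P.length ∧
    ∀ (t : ℕ) (ht : t < P.length), k ≤ t → t ≤ l →
      (OnShiftedDiagonal m P[t] ↔ t = k ∨ t = l)

/-- A lower primitive segment: all its vertices lie on or below the shifted diagonal. -/
def IsLowerPrimitiveSegment (m : ℕ) (P : List (ℤ × ℤ)) (k l : ℕ) : Prop :=
  IsPrimitiveSegment m P k l ∧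
    ∀ (t : ℕ) (ht : t < P.length), k ≤ t → t ≤ l → OnOrBelowShiftedDiagonal m P[t]

/-- Reflection of the plane over the shifted diagonal `y = x - m + 1`. -/
def reflectShifted (m : ℕ) (v : ℤ × ℤ) : ℤ × ℤ := (v.2 + (m : ℤ) - 1, v.1 - (m : ℤ) + 1)

open Classical in
/-- The flip `F(P)`: every lower primitive segment is reflected over the shifted diagonal, and the
rest of the path is kept. -/
noncomputable def flipPath (m : ℕ) (P : List (ℤ × ℤ)) : List (ℤ × ℤ) :=
  P.mapIdx fun t v =>
    if ∃ k l : ℕ, IsLowerPrimitiveSegment m P k l ∧ k ≤ t ∧ t ≤ l then reflectShifted m v else v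

/-! ### Path systems -/

/-- A subdiagonal NE path system from the `A_p` to the `B_q`: one path starting at every `A_p`,
with the endpoints forming a bijection onto the `B_q`. -/
def IsPathSystem (i m : ℕ) (P : Idx i m → List (ℤ × ℤ)) : Prop :=
  ∃ σ : Equiv.Perm (Idx i m), ∀ p : Idx i m,
    IsSubdiagonalPath (rowVertex (p : ℕ)) (colVertex m (σ p : ℕ)) (P p)

/-- No two paths of the family share a vertex. -/
def VertexDisjoint {ι : Type*} (P : ι → List (ℤ × ℤ)) : Prop :=
  ∀ p q : ι, p ≠ q → ∀ v ∈ P p, v ∉ P q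

/-- The set of doubly vertex disjoint subdiagonal NE path systems from the `A_p` to the `B_q`:
the system and its flip are both vertex disjoint. -/
def doublyVertexDisjointSystems (i m : ℕ) : Set (Idx i m → List (ℤ × ℤ)) :=
  {P | IsPathSystem i m P ∧ VertexDisjoint P ∧ VertexDisjoint fun p => flipPath m (P p)}

/-! The proof is a Lindström–Gessel–Viennot argument carried out modulo reflection in the shifted
diagonal. By the reflection principle and a ballot identity (`card_connectingPaths`), the `(p, q)`
entry of the matrix is the number of subdiagonal paths from `A_p` to `B_q`, so the determinant is a
signed sum over all path systems.

Fold the half plane below the shifted diagonal onto the upper side. Sources lie on or above that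
diagonal and targets on it, so the flip of a path is its pointwise fold
(`flipPath_eq_map_foldShifted`), and a system is doubly vertex disjoint exactly when no two paths
share a folded vertex (`neverMeet_iff`). If two paths do meet after folding, swap their tails at the
first meeting, reflecting them when the vertices there are distinct mirror images. The targets are
fixed by the reflection, so this is a sign-reversing involution and only non-meeting systems
survive.

After folding, the heights `x - y` lie in `[0, m - 1]`, and two paths at the same time have heights
of equal parity, so they cannot cross without meeting. A later source starts lower, and every target
has the maximal height `m - 1`; this forces `σ` to be the order reversal, whose sign is
`(-1)^⌊h/2⌋`.

Nonvanishing thus means that a non-meeting system exists. One is given by paths that make their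
North steps simultaneously. Conversely, at time `2⌊i/2⌋ + 1` the paths would need `h` distinct odd
heights below `m`, and there are only `⌊m/2⌋`. -/

/-! ### Tail swapping -/

section TailSwapping

variable {ι α V : Type*}

/-- The paths `x` (from the source `p`) and `y` (from the source `q`) occupy the same position
at time `s`. -/
def Meets (pos : ι → ℕ → α → Option V) (p q : ι) (s : ℕ) (x y : α) : Prop :=
  ∃ v, pos p s x = some v ∧ pos q s y = some v

/-- `s` is the first time at which two paths of the family `P` meet, and the paths from `p` and
`q` meet at that time. -/
def IsFirstMeeting (pos : ι → ℕ → α → Option V) (P : ι → α) (c : ι × ι × ℕ) : Prop :=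
  c.1 ≠ c.2.1 ∧ Meets pos c.1 c.2.1 c.2.2 (P c.1) (P c.2.1) ∧
    ∀ t < c.2.2, ∀ a b, a ≠ b → ¬ Meets pos a b t (P a) (P b)

/-- No two paths of the family meet. -/
def NeverMeet (pos : ι → ℕ → α → Option V) (P : ι → α) : Prop :=
  ∀ p q, p ≠ q → ∀ s, ¬ Meets pos p q s (P p) (P q)

theorem Meets.symm {pos : ι → ℕ → α → Option V} {p q : ι} {s : ℕ} {x y : α}
    (h : Meets pos p q s x y) : Meets pos q p s y x := by
  obtain ⟨v, h1, h2⟩ := h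
  exact ⟨v, h2, h1⟩

theorem exists_isFirstMeeting {pos : ι → ℕ → α → Option V} {P : ι → α}
    (h : ¬ NeverMeet pos P) : ∃ c, IsFirstMeeting pos P c := by
  classical
  have h' : ∃ s, ∃ p q, p ≠ q ∧ Meets pos p q s (P p) (P q) := by
    simp only [NeverMeet, not_forall, not_not] at h
    obtain ⟨p, q, hpq, s, hs⟩ := h
    exact ⟨s, p, q, hpq, hs⟩
  obtain ⟨p, q, hpq, hm⟩ := Nat.find_spec h'
  exact ⟨(p, q, Nat.find h'), hpq, hm, fun t ht a b hab hh =>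
    Nat.find_min h' ht ⟨a, b, hab, hh⟩⟩

theorem IsFirstMeeting.not_neverMeet {pos : ι → ℕ → α → Option V} {P : ι → α} {c : ι × ι × ℕ}
    (h : IsFirstMeeting pos P c) : ¬ NeverMeet pos P :=
  fun hn => hn _ _ h.1 _ h.2.1

/-- Neither family can have a first meeting later than that of `c`, and up to that time they agree.
Equality of the whole predicates makes `Exists.choose` select the same meeting before and after a
swap, so the swap is an involution. -/
theorem isFirstMeeting_congr_of_pos_eq {pos : ι → ℕ → α → Option V} {P Q : ι → α}
    {c : ι × ι × ℕ} (hc : IsFirstMeeting pos P c)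
    (h : ∀ a, ∀ t ≤ c.2.2, pos a t (Q a) = pos a t (P a)) :
    IsFirstMeeting pos Q = IsFirstMeeting pos P := by
  have key : ∀ a b, ∀ t ≤ c.2.2, Meets pos a b t (Q a) (Q b) ↔ Meets pos a b t (P a) (P b) := by
    intro a b t ht
    simp only [Meets, h a t ht, h b t ht]
  have hc' : IsFirstMeeting pos Q c :=
    ⟨hc.1, (key _ _ _ le_rfl).2 hc.2.1,
      fun t ht a b hab hh => hc.2.2 t ht a b hab ((key _ _ _ ht.le).1 hh)⟩
  ext d
  constructor
  · intro hd
    have hle : d.2.2 ≤ c.2.2 := by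
      by_contra hlt
      exact hd.2.2 _ (not_le.1 hlt) _ _ hc'.1 hc'.2.1
    exact ⟨hd.1, (key _ _ _ hle).1 hd.2.1,
      fun t ht a b hab hh => hd.2.2 t ht a b hab ((key _ _ _ (ht.le.trans hle)).2 hh)⟩
  · intro hd
    have hle : d.2.2 ≤ c.2.2 := by
      by_contra hlt
      exact hd.2.2 _ (not_le.1 hlt) _ _ hc.1 hc.2.1
    exact ⟨hd.1, (key _ _ _ hle).2 hd.2.1,
      fun t ht a b hab hh => hd.2.2 t ht a b hab ((key _ _ _ (ht.le.trans hle)).1 hh)⟩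

theorem choose_eq_choose_of_eq {β : Type*} {F G : β → Prop} (e : F = G) (hF : ∃ b, F b)
    (hG : ∃ b, G b) : hF.choose = hG.choose := by
  subst e; rfl

variable [DecidableEq ι]

/-- Exchange the tails of the paths from `p` and `q` at time `s`. -/
def swapTails (sw : ι → ι → ℕ → α → α → α) (P : ι → α) (c : ι × ι × ℕ) : ι → α :=
  Function.update
    (Function.update P c.1 (sw c.1 c.2.1 c.2.2 (P c.1) (P c.2.1)))
    c.2.1 (sw c.2.1 c.1 c.2.2 (P c.2.1) (P c.1))

/-- The sign-reversing tail swap cancels all families of paths in which two paths meet. -/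
theorem sum_sign_mul_prod_card_eq [Fintype ι] [DecidableEq α] (path : ι → ι → Finset α)
    (pos : ι → ℕ → α → Option V) (sw : ι → ι → ℕ → α → α → α)
    (sw_mem : ∀ {p q a b s x y}, x ∈ path p a → y ∈ path q b → Meets pos p q s x y →
      sw p q s x y ∈ path p b)
    (pos_sw : ∀ {p q a b s x y}, x ∈ path p a → y ∈ path q b → Meets pos p q s x y →
      ∀ t ≤ s, pos p t (sw p q s x y) = pos p t x)
    (sw_sw : ∀ {p q a b s x y}, x ∈ path p a → y ∈ path q b → Meets pos p q s x y →
      sw p q s (sw p q s x y) (sw q p s y x) = x) [DecidablePred (NeverMeet (V := V) pos)] :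
    ∑ σ : Equiv.Perm ι, (Equiv.Perm.sign σ : ℤ) * ∏ p, ((path p (σ p)).card : ℤ) =
      ∑ x ∈ ((Finset.univ : Finset (Equiv.Perm ι)).sigma
          fun σ => Fintype.piFinset fun p => path p (σ p)) with NeverMeet pos x.2,
        (Equiv.Perm.sign x.1 : ℤ) := by
  set S := (Finset.univ : Finset (Equiv.Perm ι)).sigma
    fun σ => Fintype.piFinset fun p => path p (σ p) with hS
  have hmem : ∀ x : (_ : Equiv.Perm ι) × (ι → α), x ∈ S ↔ ∀ p, x.2 p ∈ path p (x.1 p) := by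
    intro x; simp [hS]
  have hL : ∑ σ : Equiv.Perm ι, (Equiv.Perm.sign σ : ℤ) * ∏ p, ((path p (σ p)).card : ℤ) =
      ∑ x ∈ S, (Equiv.Perm.sign x.1 : ℤ) := by
    rw [hS, Finset.sum_sigma]
    refine Finset.sum_congr rfl fun σ _ => ?_
    simp [Fintype.card_piFinset, mul_comm]
  rw [hL, ← Finset.sum_filter_add_sum_filter_not S (fun x => NeverMeet pos x.2), add_eq_left]
  have hex : ∀ x ∈ S.filter (fun x => ¬ NeverMeet pos x.2), ∃ c, IsFirstMeeting pos x.2 c :=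
    fun x hx => exists_isFirstMeeting (Finset.mem_filter.1 hx).2
  have hsw1 : ∀ (P : ι → α) c, c.1 ≠ c.2.1 →
      swapTails sw P c c.1 = sw c.1 c.2.1 c.2.2 (P c.1) (P c.2.1) := by
    intro P c h; simp [swapTails, Function.update_of_ne h]
  have hsw2 : ∀ (P : ι → α) c,
      swapTails sw P c c.2.1 = sw c.2.1 c.1 c.2.2 (P c.2.1) (P c.1) := by
    intro P c; simp [swapTails]
  have hsw3 : ∀ (P : ι → α) c a, a ≠ c.1 → a ≠ c.2.1 → swapTails sw P c a = P a := by
    intro P c a h1 h2; simp [swapTails, h1, h2]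
  have hpos : ∀ x ∈ S, ∀ c, IsFirstMeeting pos x.2 c → ∀ a, ∀ t ≤ c.2.2,
      pos a t (swapTails sw x.2 c a) = pos a t (x.2 a) := by
    intro x hx c hc a t ht
    rw [hmem] at hx
    by_cases h1 : a = c.1
    · subst h1
      rw [hsw1 _ _ hc.1]
      exact pos_sw (hx _) (hx _) hc.2.1 t ht
    by_cases h2 : a = c.2.1
    · subst h2
      rw [hsw2]
      exact pos_sw (hx _) (hx _) hc.2.1.symm t ht
    rw [hsw3 _ _ _ h1 h2]
  have hfirst : ∀ x ∈ S, ∀ c, IsFirstMeeting pos x.2 c →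
      IsFirstMeeting pos (swapTails sw x.2 c) = IsFirstMeeting pos x.2 := fun x hx c hc =>
    isFirstMeeting_congr_of_pos_eq hc (hpos x hx c hc)
  refine Finset.sum_involution
    (fun x hx => ⟨x.1 * Equiv.swap (hex x hx).choose.1 (hex x hx).choose.2.1,
      swapTails sw x.2 (hex x hx).choose⟩) ?_ ?_ ?_ ?_
  · intro x hx
    have hc := (hex x hx).choose_spec
    simp [Equiv.Perm.sign_mul, Equiv.Perm.sign_swap hc.1]
  · intro x hx _ he
    have hc := (hex x hx).choose_spec
    have h1 := congrArg Sigma.fst he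
    simp only [mul_eq_left] at h1
    exact hc.1 (Equiv.swap_eq_one_iff.1 h1)
  · intro x hx
    have hc := (hex x hx).choose_spec
    set c := (hex x hx).choose
    have hxS := (Finset.mem_filter.1 hx).1
    refine Finset.mem_filter.2 ⟨?_, ?_⟩
    · rw [hmem] at hxS ⊢
      intro a
      by_cases h1 : a = c.1
      · subst h1
        simp only [hsw1 _ _ hc.1, Equiv.Perm.mul_apply, Equiv.swap_apply_left]
        exact sw_mem (hxS _) (hxS _) hc.2.1
      by_cases h2 : a = c.2.1
      · subst h2
        simp only [hsw2, Equiv.Perm.mul_apply, Equiv.swap_apply_right]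
        exact sw_mem (hxS _) (hxS _) hc.2.1.symm
      simp only [hsw3 _ _ _ h1 h2, Equiv.Perm.mul_apply, Equiv.swap_apply_of_ne_of_ne h1 h2]
      exact hxS a
    · have : IsFirstMeeting pos (swapTails sw x.2 c) c := by rw [hfirst x hxS c hc]; exact hc
      exact this.not_neverMeet
  · intro x hx
    have hc := (hex x hx).choose_spec
    have hxS := (Finset.mem_filter.1 hx).1
    generalize_proofs h1 h2
    have e : h2.choose = h1.choose :=
      choose_eq_choose_of_eq (hfirst x hxS _ hc) _ _
    simp only [e]
    replace hc : IsFirstMeeting pos x.2 h1.choose := hc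
    clear e h2
    set c := h1.choose
    rw [hmem] at hxS
    refine Sigma.ext ?_ ?_
    · simp [mul_assoc]
    · refine heq_of_eq (funext fun a => ?_)
      change swapTails sw (swapTails sw x.2 c) c a = x.2 a
      by_cases ha : a = c.1
      · subst ha
        rw [hsw1 _ _ hc.1, hsw1 _ _ hc.1, hsw2]
        exact sw_sw (hxS _) (hxS _) hc.2.1
      by_cases hb : a = c.2.1
      · subst hb
        rw [hsw2, hsw2, hsw1 _ _ hc.1]
        exact sw_sw (hxS _) (hxS _) hc.2.1.symm
      rw [hsw3 _ _ _ ha hb, hsw3 _ _ _ ha hb]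

end TailSwapping

/-! ### The sign of the reversal -/

/-- Every pair is an inversion, and `n(n-1)/2` has the parity of `⌊n/2⌋`. -/
theorem Fin.sign_revPerm (n : ℕ) :
    Equiv.Perm.sign (Fin.revPerm : Equiv.Perm (Fin n)) = (-1) ^ (n / 2) := by
  rw [Equiv.Perm.sign_eq_prod_prod_Iio]
  have h : ∀ j : Fin n, ∏ i ∈ Finset.Iio j,
      (if Fin.revPerm i < Fin.revPerm j then (1 : ℤˣ) else -1) = (-1) ^ (j : ℕ) := by
    intro j
    rw [Finset.prod_congr rfl (g := fun _ => (-1 : ℤˣ))]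
    · simp
    · intro i hi
      have := Finset.mem_Iio.1 hi
      rw [if_neg]
      simp only [Fin.revPerm_apply, Fin.rev_lt_rev, not_lt]
      exact this.le
  rw [Finset.prod_congr rfl fun j _ => h j, Finset.prod_pow_eq_pow_sum,
    Fin.sum_univ_eq_sum_range (fun i => i), Finset.sum_range_id, ← neg_one_pow_congr]
  rw [Nat.even_iff, Nat.even_iff]
  rcases Nat.even_or_odd' n with ⟨k, rfl | rfl⟩
  · have : 2 * k * (2 * k - 1) / 2 = k * (2 * k - 1) := by
      rw [mul_assoc, Nat.mul_div_cancel_left _ two_pos]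
    rw [this]
    rcases k with _ | k
    · simp
    · have : (k + 1) * (2 * (k + 1) - 1) = 2 * (k * (k + 1)) + (k + 1) := by
        have : 2 * (k + 1) - 1 = 2 * k + 1 := by omega
        rw [this]; ring
      omega
  · have : (2 * k + 1) * (2 * k + 1 - 1) / 2 = 2 * (k * k) + k := by
      have : (2 * k + 1) * (2 * k + 1 - 1) = 2 * (2 * (k * k) + k) := by
        rw [Nat.add_sub_cancel]; ring
      omega
    omega

/-! ### Subdiagonal paths by index -/

theorem isSubdiagonalPath_iff_getElem? {A B : ℤ × ℤ} {P : List (ℤ × ℤ)} :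
    IsSubdiagonalPath A B P ↔ P[0]? = some A ∧ P[P.length - 1]? = some B ∧
      (∀ (k : ℕ) v w, P[k]? = some v → P[k + 1]? = some w → IsNEStep v w) ∧
      ∀ (k : ℕ) v, P[k]? = some v → v.2 ≤ v.1 := by
  have h1 : P.IsChain IsNEStep ↔
      ∀ (k : ℕ) v w, P[k]? = some v → P[k + 1]? = some w → IsNEStep v w := by
    rw [List.isChain_iff_getElem]
    constructor
    · intro h k v w hv hw
      obtain ⟨h1, rfl⟩ := List.getElem?_eq_some_iff.1 hv
      obtain ⟨h2, rfl⟩ := List.getElem?_eq_some_iff.1 hw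
      exact h k h2
    · intro h k hk
      exact h k _ _ (List.getElem?_eq_getElem (by omega)) (List.getElem?_eq_getElem hk)
  have h2 : (∀ v ∈ P, v.2 ≤ v.1) ↔ ∀ (k : ℕ) v, P[k]? = some v → v.2 ≤ v.1 := by
    simp only [List.mem_iff_getElem?]
    exact ⟨fun h k v hk => h v ⟨k, hk⟩, fun h v ⟨k, hk⟩ => h k v hk⟩
  rw [IsSubdiagonalPath, h1, h2, List.head?_eq_getElem?, List.getLast?_eq_getElem?]

theorem IsSubdiagonalPath.length_pos {A B : ℤ × ℤ} {P : List (ℤ × ℤ)}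
    (h : IsSubdiagonalPath A B P) : 0 < P.length := by
  have := h.1
  cases P <;> simp_all

/-- The coordinate sum serves as a clock: reflection preserves it, and paths can share a vertex only
at equal times. -/
theorem IsSubdiagonalPath.fst_add_snd {A B : ℤ × ℤ} {P : List (ℤ × ℤ)}
    (h : IsSubdiagonalPath A B P) : ∀ (k : ℕ) v, P[k]? = some v → v.1 + v.2 = A.1 + A.2 + k := by
  rw [isSubdiagonalPath_iff_getElem?] at h
  intro k
  induction k with
  | zero => intro v hv; rw [h.1] at hv; simp_all
  | succ k ih =>
    intro v hv
    obtain ⟨hk, -⟩ := List.getElem?_eq_some_iff.1 hv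
    have hk' : P[k]? = some P[k] := List.getElem?_eq_getElem (by omega)
    have h1 := ih _ hk'
    push_cast
    rcases h.2.2.1 k _ _ hk' hv with e | e <;> rw [e] <;> simp only <;> linarith

theorem IsSubdiagonalPath.length_eq {A B : ℤ × ℤ} {P : List (ℤ × ℤ)}
    (h : IsSubdiagonalPath A B P) : (P.length : ℤ) = B.1 + B.2 - (A.1 + A.2) + 1 := by
  have h1 := h.length_pos
  have h2 := h.fst_add_snd _ _ (isSubdiagonalPath_iff_getElem?.1 h).2.1
  omega

theorem IsSubdiagonalPath.mono {A B : ℤ × ℤ} {P : List (ℤ × ℤ)}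
    (h : IsSubdiagonalPath A B P) {k l : ℕ} {v w : ℤ × ℤ} (hkl : k ≤ l) (hv : P[k]? = some v)
    (hw : P[l]? = some w) : v.1 ≤ w.1 ∧ v.2 ≤ w.2 := by
  induction l, hkl using Nat.le_induction generalizing w with
  | base => rw [hv] at hw; simp_all
  | succ l hkl ih =>
    obtain ⟨hk, -⟩ := List.getElem?_eq_some_iff.1 hw
    have hl : P[l]? = some P[l] := List.getElem?_eq_getElem (by omega)
    have h1 := ih hl
    rcases (isSubdiagonalPath_iff_getElem?.1 h).2.2.1 l _ _ hl hw with e | e <;> rw [e] <;>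
      simp only <;> omega

/-! ### Counting subdiagonal paths -/

/-- The subdiagonal paths with `n` steps from `A` to `B`. -/
def subdiagonalPaths (B : ℤ × ℤ) : ℕ → ℤ × ℤ → Finset (List (ℤ × ℤ))
  | 0, A => if A = B ∧ A.2 ≤ A.1 then {[A]} else ∅
  | n + 1, A => if A.2 ≤ A.1 then
      (subdiagonalPaths B n (A.1, A.2 + 1)).image (List.cons A) ∪
        (subdiagonalPaths B n (A.1 + 1, A.2)).image (List.cons A) else ∅

theorem isSubdiagonalPath_cons_cons {A B a b : ℤ × ℤ} {P : List (ℤ × ℤ)} :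
    IsSubdiagonalPath A B (a :: b :: P) ↔
      a = A ∧ A.2 ≤ A.1 ∧ IsNEStep A b ∧ IsSubdiagonalPath b B (b :: P) := by
  simp only [IsSubdiagonalPath, List.head?_cons, Option.some.injEq, List.getLast?_cons_cons,
    List.isChain_cons_cons, List.forall_mem_cons]
  constructor
  · rintro ⟨rfl, h1, ⟨h2, h3⟩, h4, h5⟩
    exact ⟨rfl, h4, h2, trivial, h1, h3, h5⟩
  · rintro ⟨rfl, h4, h2, -, h1, h3, h5⟩
    exact ⟨rfl, h1, ⟨h2, h3⟩, h4, h5⟩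

theorem mem_subdiagonalPaths {B : ℤ × ℤ} {n : ℕ} {A : ℤ × ℤ} {P : List (ℤ × ℤ)} :
    P ∈ subdiagonalPaths B n A ↔ IsSubdiagonalPath A B P ∧ P.length = n + 1 := by
  induction n generalizing A P with
  | zero =>
    rw [subdiagonalPaths]
    constructor
    · intro h
      split_ifs at h with hA
      · obtain rfl := Finset.mem_singleton.1 h
        obtain ⟨rfl, hA⟩ := hA
        simp [IsSubdiagonalPath, hA]
      · simp at h
    · rintro ⟨h, hl⟩
      obtain ⟨a, rfl⟩ := List.length_eq_one_iff.1 hl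
      simp only [IsSubdiagonalPath, List.head?_cons, Option.some.injEq, List.getLast?_singleton,
        List.mem_singleton, forall_eq] at h
      obtain ⟨rfl, rfl, -, h⟩ := h
      simp [h]
  | succ n ih =>
    rw [subdiagonalPaths]
    match P with
    | [] =>
      simp only [List.length_nil]
      split_ifs <;> simp
    | [a] =>
      have h0 : ∀ C : ℤ × ℤ, [] ∉ subdiagonalPaths B n C := fun C h => by simpa using (ih.1 h).2
      split_ifs <;> simp [h0]
    | a :: b :: P =>
      rw [isSubdiagonalPath_cons_cons]
      have key : ∀ C : ℤ × ℤ, b :: P ∈ subdiagonalPaths B n C ↔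
          C = b ∧ IsSubdiagonalPath b B (b :: P) ∧ (b :: P).length = n + 1 := by
        intro C
        rw [ih]
        constructor
        · rintro ⟨h1, h2⟩
          have : b = C := by simpa using h1.1
          subst this
          exact ⟨rfl, h1, h2⟩
        · rintro ⟨rfl, h1, h2⟩
          exact ⟨h1, h2⟩
      have hlen : (a :: b :: P).length = n + 1 + 1 ↔ (b :: P).length = n + 1 := by simp
      rw [hlen]
      split_ifs with hA
      · simp only [Finset.mem_union, Finset.mem_image, List.cons.injEq, exists_eq_right_right,
          key, IsNEStep]
        constructor
        · rintro (⟨⟨rfl, h1, h2⟩, rfl⟩ | ⟨⟨rfl, h1, h2⟩, rfl⟩)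
          · exact ⟨⟨rfl, hA, Or.inl rfl, h1⟩, h2⟩
          · exact ⟨⟨rfl, hA, Or.inr rfl, h1⟩, h2⟩
        · rintro ⟨⟨rfl, -, rfl | rfl, h1⟩, h2⟩
          · exact Or.inl ⟨⟨rfl, h1, h2⟩, rfl⟩
          · exact Or.inr ⟨⟨rfl, h1, h2⟩, rfl⟩
      · simp [hA]

theorem card_subdiagonalPaths_succ {B : ℤ × ℤ} {n : ℕ} {A : ℤ × ℤ} (hA : A.2 ≤ A.1) :
    (subdiagonalPaths B (n + 1) A).card = (subdiagonalPaths B n (A.1, A.2 + 1)).card +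
      (subdiagonalPaths B n (A.1 + 1, A.2)).card := by
  rw [subdiagonalPaths, if_pos hA, Finset.card_union_of_disjoint,
    Finset.card_image_of_injective _ List.cons_injective,
    Finset.card_image_of_injective _ List.cons_injective]
  rw [Finset.disjoint_left]
  intro P h1 h2
  obtain ⟨Q, hQ, rfl⟩ := Finset.mem_image.1 h1
  obtain ⟨R, hR, e⟩ := Finset.mem_image.1 h2
  obtain rfl := List.cons_injective e
  have e1 := (mem_subdiagonalPaths.1 hQ).1.1
  have e2 := (mem_subdiagonalPaths.1 hR).1.1
  rw [e1] at e2
  simp at e2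

theorem intBinom_natCast (n : ℕ) (k : ℕ) : intBinom n k = n.choose k := by
  simp [intBinom, Ring.choose_natCast]

theorem intBinom_of_neg (n : ℤ) {k : ℤ} (hk : k < 0) : intBinom n k = 0 := by
  simp [intBinom, hk]

theorem intBinom_succ (n : ℕ) (k : ℤ) :
    intBinom ((n + 1 : ℕ) : ℤ) k = intBinom n (k - 1) + intBinom n k := by
  rcases lt_trichotomy k 0 with hk | rfl | hk
  · rw [intBinom_of_neg _ hk, intBinom_of_neg _ hk, intBinom_of_neg _ (by omega), add_zero]
  · have h := intBinom_natCast (n + 1) 0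
    have h' := intBinom_natCast n 0
    simp only [Nat.cast_zero, Nat.choose_zero_right] at h h'
    rw [h, h', intBinom_of_neg _ (by omega)]; simp
  · obtain ⟨k, rfl⟩ : ∃ l : ℕ, k = ((l + 1 : ℕ) : ℤ) := ⟨(k - 1).toNat, by omega⟩
    have : (((k + 1 : ℕ) : ℤ) - 1) = k := by push_cast; ring
    rw [this, intBinom_natCast, intBinom_natCast, intBinom_natCast, Nat.choose_succ_succ]
    push_cast; ring

/-- The reflection principle for subdiagonal paths. -/
theorem card_subdiagonalPaths {B : ℤ × ℤ} (hB : B.2 ≤ B.1) {n : ℕ} {A : ℤ × ℤ}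
    (hA : A.2 ≤ A.1 + 1) (hn : B.1 + B.2 = A.1 + A.2 + n) :
    ((subdiagonalPaths B n A).card : ℤ) =
      intBinom n (B.2 - A.2) - intBinom n (B.2 - A.1 - 1) := by
  -- Boundary condition on `y = x + 1`, where both sides vanish. Admitting this line in `hA` lets
  -- the induction take a North step from the main diagonal.
  have hzero : ∀ (n : ℕ) (A : ℤ × ℤ), A.2 = A.1 + 1 → ((subdiagonalPaths B n A).card : ℤ) =
      intBinom n (B.2 - A.2) - intBinom n (B.2 - A.1 - 1) := by
    intro n A h
    have h1 : B.2 - A.2 = B.2 - A.1 - 1 := by omega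
    have h2 : ¬ A.2 ≤ A.1 := by omega
    rw [h1]
    cases n <;> simp [subdiagonalPaths, h2]
  induction n generalizing A with
  | zero =>
    rcases hA.lt_or_eq with hA | hA
    · have hA : A.2 ≤ A.1 := by omega
      rw [subdiagonalPaths, intBinom_of_neg _ (k := B.2 - A.1 - 1) (by push_cast at hn; omega)]
      rcases lt_trichotomy B.2 A.2 with h | h | h
      · rw [if_neg, intBinom_of_neg _ (by omega)]
        · simp
        · rintro ⟨rfl, -⟩; omega
      · have hAB : A = B := Prod.ext (by push_cast at hn; omega) h.symm
        subst hAB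
        have := intBinom_natCast 0 0
        simp only [Nat.cast_zero] at this
        simp [hA, this]
      · obtain ⟨k, hk⟩ : ∃ l : ℕ, B.2 - A.2 = ((l + 1 : ℕ) : ℤ) := ⟨(B.2 - A.2 - 1).toNat, by omega⟩
        rw [hk, intBinom_natCast, if_neg]
        · simp
        · rintro ⟨rfl, -⟩; omega
    · exact hzero _ _ hA
  | succ n ih =>
    rcases hA.lt_or_eq with hA | hA
    · have hA : A.2 ≤ A.1 := by omega
      rw [card_subdiagonalPaths_succ hA, Nat.cast_add, ih (by simp only; omega)
        (by simp only; push_cast at hn; omega), ih (by simp only; omega)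
        (by simp only; push_cast at hn; omega), intBinom_succ, intBinom_succ]
      simp only
      have e1 : B.2 - (A.2 + 1) = B.2 - A.2 - 1 := by ring
      have e2 : B.2 - (A.1 + 1) - 1 = B.2 - A.1 - 1 - 1 := by ring
      rw [e1, e2]
      ring
    · exact hzero _ _ hA

/-- The ballot number identity. -/
theorem ballot_identity {n k : ℕ} (m : ℕ) (h : n + 1 = m + 2 * k) :
    ((n + 1 : ℕ) : ℚ) * ((intBinom n k - intBinom n (k - 1) : ℤ) : ℚ) =
      m * (intBinom ((n + 1 : ℕ) : ℤ) k : ℚ) := by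
  rcases k with _ | k
  · have h1 := intBinom_natCast n 0
    have h2 := intBinom_natCast (n + 1) 0
    simp only [Nat.choose_zero_right] at h1 h2
    rw [h1, h2, intBinom_of_neg _ (by simp)]
    simp [h]
  · have e : (((k + 1 : ℕ) : ℤ) - 1) = k := by push_cast; ring
    rw [e, intBinom_natCast, intBinom_natCast, intBinom_natCast]
    have h1 := Nat.add_one_mul_choose_eq n k
    have h2 := Nat.choose_succ_succ n k
    simp only [Nat.succ_eq_add_one] at h1 h2
    have h3 : ((n + 1 : ℕ) : ℚ) * n.choose k = (n + 1).choose (k + 1) * (k + 1 : ℕ) := by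
      exact_mod_cast h1
    have h4 : ((n + 1).choose (k + 1) : ℚ) = n.choose k + n.choose (k + 1) := by exact_mod_cast h2
    have h5 : ((n + 1 : ℕ) : ℚ) = m + 2 * (k + 1 : ℕ) := by exact_mod_cast h
    push_cast at *
    have h6 : (n.choose (k + 1) : ℚ) = (n + 1).choose (k + 1) - n.choose k := by linarith
    rw [h6]
    linear_combination (-2 : ℚ) * h3 + ((n + 1).choose (k + 1) : ℚ) * h5

/-! ### The entries of the matrix count paths -/

/-- The subdiagonal paths from `A_p` to `B_q`. -/
def connectingPaths (m p q : ℕ) : Finset (List (ℤ × ℤ)) :=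
  subdiagonalPaths (colVertex m q) (3 * m - 3 - 2 * p - 2 * q) (rowVertex p)

theorem mem_connectingPaths {m p q : ℕ} (h : 2 * p + 2 * q + 3 ≤ 3 * m) {P : List (ℤ × ℤ)} :
    P ∈ connectingPaths m p q ↔ IsSubdiagonalPath (rowVertex p) (colVertex m q) P := by
  rw [connectingPaths, mem_subdiagonalPaths, and_iff_left_iff_imp]
  intro hP
  have := hP.length_eq
  simp only [rowVertex, colVertex] at this
  omega

theorem card_connectingPaths {m p q : ℕ} (h : 2 * p + 2 * q + 3 ≤ 3 * m) :
    ((connectingPaths m p q).card : ℚ) =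
      (m : ℚ) / (3 * (m : ℚ) - 2 - 2 * (p : ℚ) - 2 * (q : ℚ)) *
        (intBinom (3 * (m : ℤ) - 2 - 2 * (p : ℤ) - 2 * (q : ℤ))
          ((m : ℤ) - 1 - (p : ℤ) - (q : ℤ)) : ℚ) := by
  obtain ⟨n, hn⟩ : ∃ n, 3 * m = n + 3 + 2 * p + 2 * q := ⟨3 * m - 3 - 2 * p - 2 * q, by omega⟩
  have hn' : 3 * m - 3 - 2 * p - 2 * q = n := by omega
  have hnQ : (3 * (m : ℚ) - 2 - 2 * (p : ℚ) - 2 * (q : ℚ)) = ((n + 1 : ℕ) : ℚ) := by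
    have : (3 * m : ℚ) = n + 3 + 2 * p + 2 * q := by exact_mod_cast hn
    push_cast; linarith
  have hnZ : (3 * (m : ℤ) - 2 - 2 * (p : ℤ) - 2 * (q : ℤ)) = ((n + 1 : ℕ) : ℤ) := by omega
  have hcard : ((connectingPaths m p q).card : ℤ) =
      intBinom n ((m : ℤ) - 1 - p - q) - intBinom n ((m : ℤ) - 1 - p - q - 1) := by
    rw [connectingPaths, hn', card_subdiagonalPaths (by simp only [colVertex]; omega)
      (by simp [rowVertex]) (by simp only [rowVertex, colVertex]; omega)]
    simp only [rowVertex, colVertex]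
    congr 2 <;> ring
  have hcast : ((connectingPaths m p q).card : ℚ) =
      (((connectingPaths m p q).card : ℤ) : ℚ) := by simp
  rw [hcast, hcard, hnQ, hnZ]
  rcases lt_or_ge (m - 1 - p - q : ℤ) 0 with hk | hk
  · simp [intBinom_of_neg _ hk, intBinom_of_neg _ (show (m - 1 - p - q - 1 : ℤ) < 0 by omega)]
  · obtain ⟨k, hk⟩ := Int.eq_ofNat_of_zero_le hk
    rw [hk]
    -- Here `n + 1 = 3m - 2 - 2p - 2q = m + 2k`.
    have := ballot_identity (n := n) (k := k) m (by omega)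
    have hne : ((n + 1 : ℕ) : ℚ) ≠ 0 := by positivity
    field_simp
    linarith

/-! ### Folding along the shifted diagonal -/

/-- Reflection of the half plane strictly below the shifted diagonal; the identity elsewhere. -/
def foldShifted (m : ℕ) (v : ℤ × ℤ) : ℤ × ℤ :=
  if v.2 < v.1 - (m : ℤ) + 1 then reflectShifted m v else v

theorem reflectShifted_reflectShifted (m : ℕ) (v : ℤ × ℤ) :
    reflectShifted m (reflectShifted m v) = v := by
  ext <;> simp only [reflectShifted] <;> ring

theorem IsNEStep.reflectShifted {v w : ℤ × ℤ} (h : IsNEStep v w) (m : ℕ) :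
    IsNEStep (reflectShifted m v) (reflectShifted m w) := by
  rcases h with rfl | rfl
  · right; ext <;> simp [_root_.reflectShifted]; ring
  · left; ext <;> simp [_root_.reflectShifted]; ring

theorem foldShifted_eq_or (m : ℕ) (v : ℤ × ℤ) :
    foldShifted m v = v ∨ foldShifted m v = reflectShifted m v := by
  rw [foldShifted]
  split_ifs
  · exact Or.inr rfl
  · exact Or.inl rfl

theorem eq_or_eq_reflectShifted_of_foldShifted_eq {m : ℕ} {v w : ℤ × ℤ}
    (h : foldShifted m v = foldShifted m w) : v = w ∨ v = reflectShifted m w := by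
  rcases foldShifted_eq_or m v with h1 | h1 <;> rcases foldShifted_eq_or m w with h2 | h2 <;>
    rw [h1, h2] at h
  · exact Or.inl h
  · exact Or.inr h
  · right; rw [← h, reflectShifted_reflectShifted]
  · left; rw [← reflectShifted_reflectShifted m v, h, reflectShifted_reflectShifted]

/-- A vertex strictly below the shifted diagonal lies in a lower primitive segment. -/
theorem exists_isLowerPrimitiveSegment {m : ℕ} {A B : ℤ × ℤ} {P : List (ℤ × ℤ)}
    (hP : IsSubdiagonalPath A B P) (hA : A.1 - (m : ℤ) + 1 ≤ A.2) (hB : OnShiftedDiagonal m B)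
    {t : ℕ} (ht : t < P.length) (hv : P[t].2 < P[t].1 - (m : ℤ) + 1) :
    ∃ k l : ℕ, IsLowerPrimitiveSegment m P k l ∧ k ≤ t ∧ t ≤ l := by
  classical
  obtain ⟨h0, hlast, hstep, -⟩ := isSubdiagonalPath_iff_getElem?.1 hP
  have hlen := hP.length_pos
  -- `g` is the depth below the shifted diagonal. It changes by at most one per step, is nonpositive
  -- at the start and zero at the end, so its nearest zeros around `t` bound the segment.
  set g : ℕ → ℤ := fun j => if h : j < P.length then P[j].1 - (m : ℤ) + 1 - P[j].2 else 0 with hg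
  have hg' : ∀ j (h : j < P.length), g j = P[j].1 - (m : ℤ) + 1 - P[j].2 := by
    intro j h; simp [hg, h]
  have hgs : ∀ j, j + 1 < P.length → g (j + 1) ≤ g j + 1 ∧ g j ≤ g (j + 1) + 1 := by
    intro j h
    rw [hg' _ h, hg' _ (by omega)]
    rcases hstep j _ _ (List.getElem?_eq_getElem (by omega)) (List.getElem?_eq_getElem h) with
      e | e <;> rw [e] <;> simp only <;> omega
  have hg0 : g 0 ≤ 0 := by
    rw [hg' _ hlen]
    rw [List.getElem?_eq_getElem hlen, Option.some.injEq] at h0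
    rw [h0]; omega
  have hgl : g (P.length - 1) = 0 := by
    rw [hg' _ (by omega)]
    rw [List.getElem?_eq_getElem (by omega), Option.some.injEq] at hlast
    rw [hlast]; simp only [OnShiftedDiagonal] at hB; omega
  have hgt : 0 < g t := by rw [hg' _ ht]; omega
  set k := Nat.findGreatest (fun j => g j ≤ 0) t with hk
  have hkt : k ≤ t := Nat.findGreatest_le t
  have hk0 : g k ≤ 0 := Nat.findGreatest_spec (P := fun j => g j ≤ 0) (Nat.zero_le t) hg0
  have hkpos : ∀ j, k < j → j ≤ t → 0 < g j := fun j h1 h2 =>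
    not_le.1 (Nat.findGreatest_is_greatest (P := fun j => g j ≤ 0) h1 h2)
  have hkt' : k < t := by
    rcases hkt.lt_or_eq with h | h
    · exact h
    · rw [h] at hk0; omega
  have hk0' : g k = 0 := by
    have := hkpos (k + 1) (by omega) (by omega)
    have := hgs k (by omega)
    omega
  have hex : ∃ j, t ≤ j ∧ g j ≤ 0 := ⟨P.length - 1, by omega, hgl.le⟩
  set l := Nat.find hex with hl
  obtain ⟨htl, hl0⟩ := Nat.find_spec hex
  rw [← hl] at htl hl0
  have hllen : l ≤ P.length - 1 := Nat.find_min' hex ⟨by omega, hgl.le⟩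
  have hlpos : ∀ j, t ≤ j → j < l → 0 < g j := fun j h1 h2 => by
    have := Nat.find_min hex h2
    simp only [not_and, not_le] at this
    exact this h1
  have htl' : t < l := by
    rcases htl.lt_or_eq with h | h
    · exact h
    · rw [← h] at hl0; omega
  have hl0' : g l = 0 := by
    have := hlpos (l - 1) (by omega) (by omega)
    have := hgs (l - 1) (by omega)
    rw [Nat.sub_add_cancel (by omega)] at this
    omega
  have hpos : ∀ j, k < j → j < l → 0 < g j := fun j h1 h2 => by
    rcases le_total j t with h | h
    · exact hkpos j h1 h
    · exact hlpos j h h2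
  refine ⟨k, l, ⟨⟨by omega, by omega, fun j hj h1 h2 => ?_⟩, fun j hj h1 h2 => ?_⟩, hkt, htl⟩
  · have e := hg' j hj
    have : OnShiftedDiagonal m P[j] ↔ g j = 0 := by
      rw [OnShiftedDiagonal, e]; omega
    rw [this]
    constructor
    · intro hj0
      by_contra hne
      have := hpos j (by omega) (by omega)
      omega
    · rintro (rfl | rfl) <;> assumption
  · have e := hg' j hj
    rw [OnOrBelowShiftedDiagonal]
    have : 0 ≤ g j := by
      rcases h1.lt_or_eq with h1 | rfl
      · rcases h2.lt_or_eq with h2 | h2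
        · exact (hpos j h1 h2).le
        · rw [h2, hl0']
      · rw [hk0']
    omega

theorem flipPath_eq_map_foldShifted {m : ℕ} {A B : ℤ × ℤ} {P : List (ℤ × ℤ)}
    (hP : IsSubdiagonalPath A B P) (hA : A.1 - (m : ℤ) + 1 ≤ A.2) (hB : OnShiftedDiagonal m B) :
    flipPath m P = P.map (foldShifted m) := by
  refine List.ext_getElem (by simp [flipPath]) fun t h1 h2 => ?_
  have ht : t < P.length := by simpa using h2
  simp only [flipPath, List.getElem_mapIdx, List.getElem_map, foldShifted]
  by_cases hv : P[t].2 < P[t].1 - (m : ℤ) + 1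
  · rw [if_pos hv, if_pos (exists_isLowerPrimitiveSegment hP hA hB ht hv)]
  · rw [if_neg hv]
    split_ifs with h
    -- Such a vertex lies on the shifted diagonal itself, where the reflection is the identity.
    · obtain ⟨k, l, h, hk, hl⟩ := h
      have := h.2 t ht hk hl
      simp only [OnOrBelowShiftedDiagonal] at this
      ext <;> simp only [reflectShifted] <;> omega
    · rfl

/-! ### Swapping tails of lattice paths -/

/-- The folded position at time `s` of a path from `A_p`; the time of a vertex is its sum of
coordinates. -/
def foldedPosition (m p s : ℕ) (P : List (ℤ × ℤ)) : Option (ℤ × ℤ) :=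
  if 2 * p ≤ s then P[s - 2 * p]?.map (foldShifted m) else none

/-- Follow `P` up to time `s` and continue along `Q`, reflected if necessary. -/
def spliceTail (m p q s : ℕ) (P Q : List (ℤ × ℤ)) : List (ℤ × ℤ) :=
  P.take (s - 2 * p) ++ (Q.drop (s - 2 * q)).map
    (if P[s - 2 * p]? = Q[s - 2 * q]? then id else reflectShifted m)

theorem foldedPosition_eq_some {m p s : ℕ} {P : List (ℤ × ℤ)} {v : ℤ × ℤ} :
    foldedPosition m p s P = some v ↔
      2 * p ≤ s ∧ ∃ w, P[s - 2 * p]? = some w ∧ foldShifted m w = v := by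
  rw [foldedPosition]
  split_ifs with h <;> simp [h]

section Splice

variable {m p q a b s : ℕ} {P Q : List (ℤ × ℤ)}

/-- The data of two paths meeting after folding. -/
theorem exists_of_meets (h : Meets (foldedPosition m) p q s P Q) :
    2 * p ≤ s ∧ 2 * q ≤ s ∧ ∃ v w, P[s - 2 * p]? = some v ∧ Q[s - 2 * q]? = some w ∧
      (if P[s - 2 * p]? = Q[s - 2 * q]? then id else reflectShifted m) w = v := by
  obtain ⟨u, h1, h2⟩ := h
  obtain ⟨hp, v, hv, hvu⟩ := foldedPosition_eq_some.1 h1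
  obtain ⟨hq, w, hw, hwu⟩ := foldedPosition_eq_some.1 h2
  refine ⟨hp, hq, v, w, hv, hw, ?_⟩
  rw [hv, hw]
  rcases eq_or_eq_reflectShifted_of_foldShifted_eq (hvu.trans hwu.symm) with rfl | h
  · simp
  · split_ifs with e
    · exact (Option.some.inj e).symm
    · exact h.symm

theorem getElem?_spliceTail {v : ℤ × ℤ} (hv : P[s - 2 * p]? = some v) (k : ℕ) :
    (spliceTail m p q s P Q)[k]? = if k < s - 2 * p then P[k]? else
      Q[k - (s - 2 * p) + (s - 2 * q)]?.map
        (if P[s - 2 * p]? = Q[s - 2 * q]? then id else reflectShifted m) := by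
  obtain ⟨hlt, -⟩ := List.getElem?_eq_some_iff.1 hv
  have hlen : (P.take (s - 2 * p)).length = s - 2 * p := by simp; omega
  rw [spliceTail, List.getElem?_append, hlen]
  split_ifs with h1 <;> simp [h1, add_comm]

theorem isSubdiagonalPath_spliceTail
    (hP : IsSubdiagonalPath (rowVertex p) (colVertex m a) P)
    (hQ : IsSubdiagonalPath (rowVertex q) (colVertex m b) Q)
    (h : Meets (foldedPosition m) p q s P Q) :
    IsSubdiagonalPath (rowVertex p) (colVertex m b) (spliceTail m p q s P Q) := by
  obtain ⟨hp, hq, v, w, hv, hw, hρ⟩ := exists_of_meets h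
  have hget := getElem?_spliceTail (m := m) (q := q) (Q := Q) hv
  have hlen : (spliceTail m p q s P Q).length = (s - 2 * p) + (Q.length - (s - 2 * q)) := by
    obtain ⟨hlt, -⟩ := List.getElem?_eq_some_iff.1 hv
    simp [spliceTail]; omega
  obtain ⟨hlw, -⟩ := List.getElem?_eq_some_iff.1 hw
  set ρ : ℤ × ℤ → ℤ × ℤ := if P[s - 2 * p]? = Q[s - 2 * q]? then id else reflectShifted m with hρd
  have hρstep : ∀ x y, IsNEStep x y → IsNEStep (ρ x) (ρ y) := by
    intro x y hxy
    rw [hρd]; split_ifs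
    · exact hxy
    · exact hxy.reflectShifted m
  have hρB : ρ (colVertex m b) = colVertex m b := by
    rw [hρd]; split_ifs
    · rfl
    · ext <;> simp only [reflectShifted, colVertex] <;> ring
  obtain ⟨hP0, hPl, hPs, hPd⟩ := isSubdiagonalPath_iff_getElem?.1 hP
  obtain ⟨hQ0, hQl, hQs, hQd⟩ := isSubdiagonalPath_iff_getElem?.1 hQ
  -- A reflected vertex is subdiagonal when `x - y ≤ 2m - 2`; monotonicity along `Q` gives `x ≤ 2m -
  -- 2 - b` and `y ≥ q`.
  have hρd : ∀ (k : ℕ) x, Q[k]? = some x → (ρ x).2 ≤ (ρ x).1 := by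
    intro k x hx
    have h1 := hQd k x hx
    obtain ⟨hk, -⟩ := List.getElem?_eq_some_iff.1 hx
    have h2 := hQ.mono (Nat.zero_le k) hQ0 hx
    have h3 := hQ.mono (show k ≤ Q.length - 1 by omega) hx hQl
    simp only [rowVertex, colVertex] at h2 h3
    rw [hρd]; split_ifs
    · exact h1
    · simp only [reflectShifted]; omega
  rw [isSubdiagonalPath_iff_getElem?]
  refine ⟨?_, ?_, ?_, ?_⟩
  · rw [hget]
    split_ifs with h0
    · exact hP0
    · have e : s - 2 * p = 0 := by omega
      rw [e] at hv ⊢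
      rw [Nat.sub_self, zero_add, hw, Option.map_some, hρ, ← hv, hP0]
  · rw [hget, hlen, if_neg (by omega)]
    have e : s - 2 * p + (Q.length - (s - 2 * q)) - 1 - (s - 2 * p) + (s - 2 * q) =
      Q.length - 1 := by omega
    rw [e, hQl, Option.map_some, hρB]
  · intro k x y hx hy
    rw [hget] at hx hy
    split_ifs at hx hy with h1 h2 h2
    · exact hPs k x y hx hy
    · have e : s - 2 * p = k + 1 := by omega
      rw [e] at hv hy
      rw [Nat.sub_self, zero_add, hw, Option.map_some, hρ] at hy
      exact hPs k x y hx (hv.trans hy)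
    · omega
    · obtain ⟨x', hx', rfl⟩ := Option.map_eq_some_iff.1 hx
      obtain ⟨y', hy', rfl⟩ := Option.map_eq_some_iff.1 hy
      refine hρstep _ _ (hQs _ _ _ hx' ?_)
      rw [← hy']
      congr 1
      omega
  · intro k x hx
    rw [hget] at hx
    split_ifs at hx with h1
    · exact hPd k x hx
    · obtain ⟨x', hx', rfl⟩ := Option.map_eq_some_iff.1 hx
      exact hρd _ _ hx'

theorem getElem?_spliceTail_of_le (h : Meets (foldedPosition m) p q s P Q) {k : ℕ}
    (hk : k ≤ s - 2 * p) : (spliceTail m p q s P Q)[k]? = P[k]? := by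
  obtain ⟨hp, hq, v, w, hv, hw, hρ⟩ := exists_of_meets h
  rw [getElem?_spliceTail hv]
  by_cases h1 : k < s - 2 * p
  · rw [if_pos h1]
  · rw [if_neg h1]
    obtain rfl : k = s - 2 * p := by omega
    rw [hw] at hρ
    rw [Nat.sub_self, zero_add, hw, Option.map_some, hρ, hv]

theorem foldedPosition_spliceTail (h : Meets (foldedPosition m) p q s P Q) {t : ℕ} (ht : t ≤ s) :
    foldedPosition m p t (spliceTail m p q s P Q) = foldedPosition m p t P := by
  rw [foldedPosition, foldedPosition]
  split_ifs with hpt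
  · rw [getElem?_spliceTail_of_le h (by omega)]
  · rfl

/-- Whether to reflect is decided by the two vertices at time `s`, which the swap does not move.
Hence the second swap reflects exactly when the first did, and the reflections cancel. -/
theorem spliceTail_spliceTail (h : Meets (foldedPosition m) p q s P Q) :
    spliceTail m p q s (spliceTail m p q s P Q) (spliceTail m q p s Q P) = P := by
  obtain ⟨hp, hq, v, w, hv, hw, hρ⟩ := exists_of_meets h
  have h1 := getElem?_spliceTail_of_le h le_rfl
  have h2 := getElem?_spliceTail_of_le h.symm le_rfl
  refine List.ext_getElem? fun k => ?_
  rw [getElem?_spliceTail (h1.trans hv)]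
  split_ifs with h3 h4
  · exact getElem?_spliceTail_of_le h h3.le
  all_goals
    rw [getElem?_spliceTail hw, if_neg (by omega)]
    have e : k - (s - 2 * p) + (s - 2 * q) - (s - 2 * q) + (s - 2 * p) = k := by omega
    rw [h1, h2] at h4
  · rw [if_pos h4.symm, e]; simp
  · rw [if_neg (Ne.symm h4), e]
    simp only [Option.map_map]
    have : reflectShifted m ∘ reflectShifted m = id :=
      funext (reflectShifted_reflectShifted m)
    rw [this, Option.map_id, id]

end Splice

/-! ### Heights of folded vertices -/

/-- The distance `x - y` from the main diagonal after folding. -/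
def foldedHeight (m : ℕ) (v : ℤ × ℤ) : ℤ := (foldShifted m v).1 - (foldShifted m v).2

theorem foldedHeight_eq (m : ℕ) (v : ℤ × ℤ) :
    foldedHeight m v = if v.2 < v.1 - (m : ℤ) + 1 then 2 * m - 2 - (v.1 - v.2) else v.1 - v.2 := by
  rw [foldedHeight, foldShifted]
  split_ifs
  · simp only [reflectShifted]; ring
  · rfl

theorem foldShifted_fst_add_snd (m : ℕ) (v : ℤ × ℤ) :
    (foldShifted m v).1 + (foldShifted m v).2 = v.1 + v.2 := by
  rw [foldShifted]
  split_ifs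
  · simp only [reflectShifted]; ring
  · rfl

theorem foldShifted_eq_of_foldedHeight_eq {m : ℕ} {v w : ℤ × ℤ} (h : v.1 + v.2 = w.1 + w.2)
    (h' : foldedHeight m v = foldedHeight m w) : foldShifted m v = foldShifted m w := by
  have h1 := foldShifted_fst_add_snd m v
  have h2 := foldShifted_fst_add_snd m w
  rw [foldedHeight, foldedHeight] at h'
  ext <;> omega

theorem foldedHeight_le (m : ℕ) (v : ℤ × ℤ) : foldedHeight m v ≤ m - 1 := by
  rw [foldedHeight_eq]; split_ifs <;> omega

theorem foldedHeight_emod_two (m : ℕ) (v : ℤ × ℤ) :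
    foldedHeight m v % 2 = (v.1 + v.2) % 2 := by
  rw [foldedHeight_eq]; split_ifs <;> omega

theorem IsNEStep.foldedHeight_le {v w : ℤ × ℤ} (h : IsNEStep v w) (m : ℕ) :
    foldedHeight m v ≤ foldedHeight m w + 1 ∧ foldedHeight m w ≤ foldedHeight m v + 1 := by
  rw [foldedHeight_eq, foldedHeight_eq]
  rcases h with rfl | rfl <;> simp only <;> split_ifs <;> omega

section Paths

variable {m p q a b s : ℕ} {P Q : List (ℤ × ℤ)}

theorem IsSubdiagonalPath.foldedHeight_nonneg
    (hP : IsSubdiagonalPath (rowVertex p) (colVertex m a) P) {k : ℕ} {v : ℤ × ℤ}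
    (hv : P[k]? = some v) : 0 ≤ foldedHeight m v := by
  obtain ⟨h0, hl, -, hd⟩ := isSubdiagonalPath_iff_getElem?.1 hP
  obtain ⟨hk, -⟩ := List.getElem?_eq_some_iff.1 hv
  have h1 := hP.mono (Nat.zero_le k) h0 hv
  have h2 := hP.mono (show k ≤ P.length - 1 by omega) hv hl
  have h3 := hd k v hv
  simp only [rowVertex, colVertex] at h1 h2
  rw [foldedHeight_eq]; split_ifs <;> omega

theorem IsSubdiagonalPath.fst_add_snd_eq_time
    (hP : IsSubdiagonalPath (rowVertex p) (colVertex m a) P) (hp : 2 * p ≤ s) {v : ℤ × ℤ}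
    (hv : P[s - 2 * p]? = some v) : v.1 + v.2 = s := by
  have := hP.fst_add_snd _ _ hv
  simp only [rowVertex] at this
  omega

theorem IsSubdiagonalPath.exists_getElem?_eq_some
    (hP : IsSubdiagonalPath (rowVertex p) (colVertex m a) P) (hp : 2 * p ≤ s)
    (hs : s + 2 * a + 3 ≤ 3 * m) : ∃ v, P[s - 2 * p]? = some v := by
  have := hP.length_eq
  simp only [rowVertex, colVertex] at this
  exact ⟨_, List.getElem?_eq_getElem (by omega)⟩

theorem meets_of_foldedHeight_eq
    (hP : IsSubdiagonalPath (rowVertex p) (colVertex m a) P)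
    (hQ : IsSubdiagonalPath (rowVertex q) (colVertex m b) Q) (hp : 2 * p ≤ s) (hq : 2 * q ≤ s)
    {v w : ℤ × ℤ} (hv : P[s - 2 * p]? = some v) (hw : Q[s - 2 * q]? = some w)
    (h : foldedHeight m v = foldedHeight m w) : Meets (foldedPosition m) p q s P Q := by
  have h1 := hP.fst_add_snd_eq_time hp hv
  have h2 := hQ.fst_add_snd_eq_time hq hw
  exact ⟨foldShifted m v, foldedPosition_eq_some.2 ⟨hp, v, hv, rfl⟩,
    foldedPosition_eq_some.2 ⟨hq, w, hw,
      (foldShifted_eq_of_foldedHeight_eq (h1.trans h2.symm) h).symm⟩⟩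

/-- At time `2q` the path `Q` starts at height `0`. From then on the difference of heights is even
and nonzero while each height changes by at most one per step, so its sign cannot change. -/
theorem foldedHeight_lt_of_not_meets
    (hP : IsSubdiagonalPath (rowVertex p) (colVertex m a) P)
    (hQ : IsSubdiagonalPath (rowVertex q) (colVertex m b) Q) (hpq : p < q)
    (h : ∀ s, ¬ Meets (foldedPosition m) p q s P Q) (hqs : 2 * q ≤ s)
    {v w : ℤ × ℤ} (hv : P[s - 2 * p]? = some v) (hw : Q[s - 2 * q]? = some w) :
    foldedHeight m w < foldedHeight m v := by
  have hPi := isSubdiagonalPath_iff_getElem?.1 hP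
  have hQi := isSubdiagonalPath_iff_getElem?.1 hQ
  induction s, hqs using Nat.le_induction generalizing v w with
  | base =>
    have hne : foldedHeight m v ≠ foldedHeight m w := fun e =>
      h _ (meets_of_foldedHeight_eq hP hQ (by omega) le_rfl hv hw e)
    have h0 := hP.foldedHeight_nonneg hv
    have h1 := hQ.foldedHeight_nonneg hw
    rw [Nat.sub_self, hQi.1, Option.some.injEq] at hw
    have h2 : foldedHeight m w ≤ 0 := by
      rw [foldedHeight_eq, ← hw]
      simp only [rowVertex]
      have := foldedHeight_le m w
      split_ifs <;> omega
    omega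
  | succ s hqs ih =>
    have hne : foldedHeight m v ≠ foldedHeight m w := fun e =>
      h _ (meets_of_foldedHeight_eq hP hQ (by omega) (by omega) hv hw e)
    obtain ⟨hlv, -⟩ := List.getElem?_eq_some_iff.1 hv
    obtain ⟨hlw, -⟩ := List.getElem?_eq_some_iff.1 hw
    have hv' : P[s - 2 * p]? = some P[s - 2 * p] := List.getElem?_eq_getElem (by omega)
    have hw' : Q[s - 2 * q]? = some Q[s - 2 * q] := List.getElem?_eq_getElem (by omega)
    have hlt := ih hv' hw'
    have e1 : s + 1 - 2 * p = s - 2 * p + 1 := by omega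
    have e2 : s + 1 - 2 * q = s - 2 * q + 1 := by omega
    have s1 := (hPi.2.2.1 _ _ _ hv' (e1 ▸ hv)).foldedHeight_le m
    have s2 := (hQi.2.2.1 _ _ _ hw' (e2 ▸ hw)).foldedHeight_le m
    have p1 := foldedHeight_emod_two m P[s - 2 * p]
    have p2 := foldedHeight_emod_two m Q[s - 2 * q]
    have t1 := hP.fst_add_snd_eq_time (by omega) hv'
    have t2 := hQ.fst_add_snd_eq_time (by omega) hw'
    rw [t1] at p1
    rw [t2] at p2
    omega

/-- Paths that do not meet after folding reach their ends in reversed order. -/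
theorem end_lt_end_of_not_meets
    (hP : IsSubdiagonalPath (rowVertex p) (colVertex m a) P)
    (hQ : IsSubdiagonalPath (rowVertex q) (colVertex m b) Q) (hpq : p < q)
    (h : ∀ s, ¬ Meets (foldedPosition m) p q s P Q) (hqb : 2 * q + 2 * b + 3 ≤ 3 * m) :
    b < a := by
  by_contra hab
  -- At this time `Q` reaches its target, at the maximal height `m - 1`. If `a ≤ b`, then `P` has
  -- not yet ended and would have to be strictly higher.
  obtain ⟨v, hv⟩ := hP.exists_getElem?_eq_some (s := 3 * m - 3 - 2 * b) (by omega) (by omega)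
  obtain ⟨w, hw⟩ := hQ.exists_getElem?_eq_some (s := 3 * m - 3 - 2 * b) (by omega) (by omega)
  have hlt := foldedHeight_lt_of_not_meets hP hQ hpq h (by omega) hv hw
  have hlen := hQ.length_eq
  simp only [rowVertex, colVertex] at hlen
  have hl := (isSubdiagonalPath_iff_getElem?.1 hQ).2.1
  have e : Q.length - 1 = 3 * m - 3 - 2 * b - 2 * q := by omega
  rw [e, hw, Option.some.injEq] at hl
  have h1 := foldedHeight_le m v
  rw [foldedHeight_eq m w, hl] at hlt
  simp only [colVertex] at hlt
  split_ifs at hlt <;> omega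

end Paths

/-! ### Path systems -/

section Systems

variable {i m : ℕ}

/-- For `m = 0` the floor is negative, so `1 ≤ m` is implied. -/
theorem two_mul_add_three_le (hi : (i : ℤ) ≤ 3 * ((m : ℤ) - 1) / 2) : 2 * i + 3 ≤ 3 * m := by
  omega

theorem Idx.bounds (p : Idx i m) : lowIndex i m ≤ p ∧ (p : ℕ) ≤ i / 2 := Finset.mem_Icc.1 p.2

theorem Idx.two_mul_add_le (hi : 2 * i + 3 ≤ 3 * m) (p q : Idx i m) :
    2 * (p : ℕ) + 2 * (q : ℕ) + 3 ≤ 3 * m := by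
  have := p.bounds
  have := q.bounds
  omega

/-- The order-reversing permutation of the index set. -/
def revIdx (i m : ℕ) : Equiv.Perm (Idx i m) :=
  Function.Involutive.toPerm
    (fun p => ⟨lowIndex i m + i / 2 - p, by
      have := p.bounds
      exact Finset.mem_Icc.2 (by omega)⟩)
    (fun p => Subtype.ext (by have := p.bounds; simp only; omega))

theorem coe_revIdx (p : Idx i m) : (revIdx i m p : ℕ) = lowIndex i m + i / 2 - p := rfl

theorem card_idx (i m : ℕ) : Fintype.card (Idx i m) = hNumber i m := by
  rw [Fintype.card_coe, Nat.card_Icc, hNumber]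
  congr 1
  omega

theorem sign_revIdx (i m : ℕ) : Equiv.Perm.sign (revIdx i m) = (-1) ^ (hNumber i m / 2) := by
  rw [← Fin.sign_revPerm]
  have hh : hNumber i m = i / 2 + 1 - lowIndex i m := by rw [hNumber]; omega
  let e : Idx i m ≃ Fin (hNumber i m) :=
    { toFun := fun p => ⟨p - lowIndex i m, by have := p.bounds; omega⟩
      invFun := fun j => ⟨j + lowIndex i m, Finset.mem_Icc.2 (by have := j.2; omega)⟩
      left_inv := fun p => Subtype.ext (by have := p.bounds; simp only; omega)
      right_inv := fun j => Fin.ext (by simp) }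
  refine Equiv.Perm.sign_eq_sign_of_equiv _ _ e fun p => Fin.ext ?_
  have := p.bounds
  simp only [e, Equiv.coe_fn_mk, coe_revIdx, Fin.revPerm_apply, Fin.val_rev]
  omega

theorem eq_revIdx_of_strictAnti {σ : Equiv.Perm (Idx i m)} (h : StrictAnti σ) :
    σ = revIdx i m := by
  have hr : StrictAnti (revIdx i m) := fun p q hpq => by
    have h1 := p.bounds
    have h2 := q.bounds
    have h3 : (p : ℕ) < q := hpq
    change (revIdx i m q : ℕ) < revIdx i m p
    rw [coe_revIdx, coe_revIdx]
    omega
  have hm : StrictMono (σ ∘ revIdx i m) := h.comp hr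
  ext1 p
  have h1 : (σ ∘ revIdx i m) (revIdx i m p) = revIdx i m p :=
    le_antisymm hm.apply_le hm.le_apply
  have h2 : revIdx i m (revIdx i m p) = p := Subtype.ext (by
    have := p.bounds
    rw [coe_revIdx, coe_revIdx]; omega)
  rwa [Function.comp_apply, h2] at h1

/-- The family of folded positions, indexed by `Idx i m`. -/
def systemPosition (i m : ℕ) (p : Idx i m) (s : ℕ) (P : List (ℤ × ℤ)) : Option (ℤ × ℤ) :=
  foldedPosition m p s P

theorem eq_revIdx_of_neverMeet (hi : 2 * i + 3 ≤ 3 * m) {σ : Equiv.Perm (Idx i m)}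
    {P : Idx i m → List (ℤ × ℤ)}
    (hP : ∀ p : Idx i m, IsSubdiagonalPath (rowVertex (p : ℕ)) (colVertex m (σ p : ℕ)) (P p))
    (h : NeverMeet (systemPosition i m) P) : σ = revIdx i m := by
  refine eq_revIdx_of_strictAnti fun p q hpq => ?_
  exact end_lt_end_of_not_meets (hP p) (hP q) hpq (h p q hpq.ne)
    (Idx.two_mul_add_le hi q (σ q))

/-- Not meeting is disjointness of the folded vertex sets, which already forces the unfolded paths
to be disjoint. -/
theorem neverMeet_iff {σ : Equiv.Perm (Idx i m)} {P : Idx i m → List (ℤ × ℤ)} (hm : 1 ≤ m)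
    (hP : ∀ p : Idx i m, IsSubdiagonalPath (rowVertex (p : ℕ)) (colVertex m (σ p : ℕ)) (P p)) :
    NeverMeet (systemPosition i m) P ↔
      VertexDisjoint P ∧ VertexDisjoint fun p => flipPath m (P p) := by
  have hflip : ∀ p, flipPath m (P p) = (P p).map (foldShifted m) := fun p =>
    flipPath_eq_map_foldShifted (hP p) (by simp only [rowVertex]; omega)
      (by simp only [OnShiftedDiagonal, colVertex]; ring)
  simp only [hflip]
  constructor
  · intro h
    have key : ∀ p q : Idx i m, p ≠ q → ∀ v ∈ P p, ∀ w ∈ P q,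
        foldShifted m v ≠ foldShifted m w := by
      intro p q hpq v hv w hw hvw
      obtain ⟨k, hk⟩ := List.mem_iff_getElem?.1 hv
      obtain ⟨l, hl⟩ := List.mem_iff_getElem?.1 hw
      have h1 := (hP p).fst_add_snd _ _ hk
      have h2 := (hP q).fst_add_snd _ _ hl
      have h3 := foldShifted_fst_add_snd m v
      have h4 := foldShifted_fst_add_snd m w
      rw [hvw] at h3
      simp only [rowVertex] at h1 h2
      have e : 2 * (p : ℕ) + k - 2 * q = l := by omega
      refine h p q hpq (2 * p + k) ⟨foldShifted m v, ?_, ?_⟩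
      · exact foldedPosition_eq_some.2 ⟨by omega, v, by rwa [Nat.add_sub_cancel_left], rfl⟩
      · exact foldedPosition_eq_some.2 ⟨by omega, w, by rwa [e], hvw.symm⟩
    refine ⟨fun p q hpq v hv hw => key p q hpq v hv v hw rfl, fun p q hpq v hv hw => ?_⟩
    obtain ⟨x, hx, rfl⟩ := List.mem_map.1 hv
    obtain ⟨y, hy, e⟩ := List.mem_map.1 hw
    exact key p q hpq x hx y hy e.symm
  · rintro ⟨-, h⟩ p q hpq s ⟨v, h1, h2⟩
    obtain ⟨-, x, hx, hxv⟩ := foldedPosition_eq_some.1 h1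
    obtain ⟨-, y, hy, hyv⟩ := foldedPosition_eq_some.1 h2
    exact h p q hpq v (List.mem_map.2 ⟨x, List.mem_of_getElem? hx, hxv⟩)
      (List.mem_map.2 ⟨y, List.mem_of_getElem? hy, hyv⟩)

open Classical in
/-- The doubly vertex disjoint systems as a finset. -/
noncomputable def doublyDisjointFinset (i m : ℕ) : Finset (Idx i m → List (ℤ × ℤ)) :=
  (Fintype.piFinset fun p : Idx i m => connectingPaths m p (revIdx i m p)).filter
    (NeverMeet (systemPosition i m))

theorem mem_doublyDisjointFinset (hi : 2 * i + 3 ≤ 3 * m) {P : Idx i m → List (ℤ × ℤ)} :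
    P ∈ doublyDisjointFinset i m ↔ (∀ p : Idx i m,
      IsSubdiagonalPath (rowVertex (p : ℕ)) (colVertex m (revIdx i m p : ℕ)) (P p)) ∧
        NeverMeet (systemPosition i m) P := by
  classical
  rw [doublyDisjointFinset, Finset.mem_filter, Fintype.mem_piFinset]
  simp only [mem_connectingPaths (Idx.two_mul_add_le hi _ _)]

theorem doublyVertexDisjointSystems_eq (hi : 2 * i + 3 ≤ 3 * m) :
    doublyVertexDisjointSystems i m = ↑(doublyDisjointFinset i m) := by
  ext P
  rw [Finset.mem_coe, mem_doublyDisjointFinset hi, doublyVertexDisjointSystems, Set.mem_ofPred_eq]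
  constructor
  · rintro ⟨⟨σ, hσ⟩, h⟩
    have h := (neverMeet_iff (by omega) hσ).2 h
    obtain rfl := eq_revIdx_of_neverMeet hi hσ h
    exact ⟨hσ, h⟩
  · rintro ⟨h1, h2⟩
    exact ⟨⟨_, h1⟩, (neverMeet_iff (by omega) h1).1 h2⟩

theorem det_pathCountMatrix (hi : 2 * i + 3 ≤ 3 * m) :
    (pathCountMatrix i m).det =
      (-1 : ℚ) ^ (hNumber i m / 2) * ((doublyDisjointFinset i m).card : ℚ) := by
  classical
  have hentry : ∀ p q, pathCountMatrix i m p q = ((connectingPaths m p q).card : ℚ) := fun p q =>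
    (card_connectingPaths (Idx.two_mul_add_le hi p q)).symm
  have hswap := sum_sign_mul_prod_card_eq
    (fun p q : Idx i m => connectingPaths m p q) (systemPosition i m)
    (fun p q => spliceTail m p q)
    (fun {p q a b s x y} hx hy h => by
      rw [mem_connectingPaths (Idx.two_mul_add_le hi _ _)] at hx hy ⊢
      exact isSubdiagonalPath_spliceTail hx hy h)
    (fun {p q a b s x y} _ _ h t ht => foldedPosition_spliceTail (p := p) (q := q) h ht)
    (fun {p q a b s x y} _ _ h => spliceTail_spliceTail (p := p) (q := q) h)
  have hsum : ∑ x ∈ ((Finset.univ : Finset (Equiv.Perm (Idx i m))).sigma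
      fun σ => Fintype.piFinset fun p : Idx i m => connectingPaths m p (σ p)) with
        NeverMeet (systemPosition i m) x.2, (Equiv.Perm.sign x.1 : ℤ) =
      (-1) ^ (hNumber i m / 2) * ((doublyDisjointFinset i m).card : ℤ) := by
    have : ∀ x ∈ ((Finset.univ : Finset (Equiv.Perm (Idx i m))).sigma
      fun σ => Fintype.piFinset fun p : Idx i m => connectingPaths m p (σ p)).filter
        (fun x => NeverMeet (systemPosition i m) x.2), x.1 = revIdx i m := by
      intro x hx
      obtain ⟨h1, h2⟩ := Finset.mem_filter.1 hx
      simp only [Finset.mem_sigma, Finset.mem_univ, true_and, Fintype.mem_piFinset,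
        mem_connectingPaths (Idx.two_mul_add_le hi _ _)] at h1
      exact eq_revIdx_of_neverMeet hi h1 h2
    rw [Finset.sum_congr rfl fun x hx => by rw [this x hx, sign_revIdx], Finset.sum_const,
      nsmul_eq_mul, mul_comm]
    congr 1
    refine congrArg _ (Finset.card_bij' (fun x _ => x.2) (fun P _ => ⟨revIdx i m, P⟩) ?_ ?_ ?_ ?_)
    · intro x hx
      have e := this x hx
      obtain ⟨σ, P⟩ := x
      simp only at e
      subst e
      simpa [doublyDisjointFinset] using hx
    · intro P hP
      simpa [doublyDisjointFinset] using hP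
    · intro x hx
      have e := this x hx
      obtain ⟨σ, P⟩ := x
      simp only at e
      subst e
      rfl
    · intro P hP
      rfl
  rw [hsum] at hswap
  -- `Matrix.det_apply'` applies `σ` to the row index, while paths run from `p` to `σ p`.
  rw [← Matrix.det_transpose, Matrix.det_apply']
  have : ∀ σ : Equiv.Perm (Idx i m), ∏ p : Idx i m, (pathCountMatrix i m).transpose (σ p) p =
      ((∏ p : Idx i m, ((connectingPaths m p (σ p)).card : ℤ) : ℤ) : ℚ) := by
    intro σ
    push_cast
    exact Finset.prod_congr rfl fun p _ => hentry p (σ p)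
  simp only [this]
  exact_mod_cast hswap

/-! ### Existence of doubly vertex disjoint systems -/

/-- Number of North steps made before time `s` by each path of the parallel system. -/
def parallelNorth (i m s : ℕ) : ℕ := min ((s - 2 * (i / 2)) / 2) (m - 1 - (lowIndex i m + i / 2))

/-- The path from `A_p` of the parallel system: East steps, then a zigzag, then East steps. -/
def parallelPath (i m p : ℕ) : List (ℤ × ℤ) :=
  (List.range (3 * m - 3 - 2 * (lowIndex i m + i / 2) + 1)).map fun k =>
    ((p : ℤ) + k - parallelNorth i m (2 * p + k), (p : ℤ) + parallelNorth i m (2 * p + k))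

theorem getElem?_parallelPath {p k : ℕ} {v : ℤ × ℤ} :
    (parallelPath i m p)[k]? = some v ↔ k ≤ 3 * m - 3 - 2 * (lowIndex i m + i / 2) ∧
      v = ((p : ℤ) + k - parallelNorth i m (2 * p + k),
        (p : ℤ) + parallelNorth i m (2 * p + k)) := by
  rw [parallelPath, List.getElem?_map, Option.map_eq_some_iff]
  simp only [List.getElem?_eq_some_iff, List.length_range, List.getElem_range]
  constructor
  · rintro ⟨_, ⟨h, rfl⟩, rfl⟩
    exact ⟨by omega, rfl⟩
  · rintro ⟨h, rfl⟩
    exact ⟨k, ⟨by omega, rfl⟩, rfl⟩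

theorem doublyDisjointFinset_nonempty (hi : 2 * i + 3 ≤ 3 * m)
    (h : 2 * hNumber i m ≤ m ∨ 2 * i + 3 = 3 * m) : (doublyDisjointFinset i m).Nonempty := by
  have hL : lowIndex i m = (i + 2 - m) / 2 := rfl
  have hh : hNumber i m = i / 2 + 1 - lowIndex i m := by rw [hNumber]; omega
  have hLU : lowIndex i m + i / 2 + 1 ≤ m := by omega
  -- Each zigzag starts with an East step, and `2h ≤ m` keeps that excess on or above the shifted
  -- diagonal. In the exceptional case `2h = m + 1` the zigzag has length zero.
  have hcase : 2 * hNumber i m ≤ m ∨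
      (2 * hNumber i m = m + 1 ∧ lowIndex i m + i / 2 + 1 = m) := by omega
  refine ⟨fun p => parallelPath i m p, (mem_doublyDisjointFinset hi).2 ⟨fun p => ?_, ?_⟩⟩
  · have hp := p.bounds
    have hq := coe_revIdx p
    have hlen : (parallelPath i m p).length =
      3 * m - 3 - 2 * (lowIndex i m + i / 2) + 1 := by simp [parallelPath]
    rw [isSubdiagonalPath_iff_getElem?]
    simp only [getElem?_parallelPath, hlen, Nat.add_sub_cancel]
    refine ⟨⟨Nat.zero_le _, ?_⟩, ⟨le_rfl, ?_⟩, ?_, ?_⟩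
    · have : parallelNorth i m (2 * p + 0) = 0 := by rw [parallelNorth]; omega
      rw [this]; simp [rowVertex]
    · have : parallelNorth i m (2 * p + (3 * m - 3 - 2 * (lowIndex i m + i / 2))) =
          m - 1 - (lowIndex i m + i / 2) := by
        rw [parallelNorth]; omega
      rw [this, hq]
      ext <;> simp only [colVertex] <;> omega
    · rintro k v w ⟨-, rfl⟩ ⟨-, rfl⟩
      have : parallelNorth i m (2 * p + (k + 1)) = parallelNorth i m (2 * p + k) ∨
          parallelNorth i m (2 * p + (k + 1)) = parallelNorth i m (2 * p + k) + 1 := by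
        simp only [parallelNorth]; omega
      rcases this with e | e <;> rw [e]
      · right; ext <;> push_cast <;> ring
      · left; ext <;> push_cast <;> ring
    · rintro k v ⟨-, rfl⟩
      have : 2 * parallelNorth i m (2 * p + k) ≤ k := by rw [parallelNorth]; omega
      simp only; omega
  · rintro p q hpq s ⟨u, h1, h2⟩
    have hfold : ∀ p : Idx i m, ∀ u, systemPosition i m p s (parallelPath i m p) = some u →
        u.2 = (p : ℤ) + parallelNorth i m s := by
      intro p u hu
      have hp := p.bounds
      obtain ⟨hps, v, hv, hvu⟩ := foldedPosition_eq_some.1 hu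
      obtain ⟨hk, rfl⟩ := getElem?_parallelPath.1 hv
      have e : 2 * (p : ℕ) + (s - 2 * p) = s := by omega
      rw [e] at hvu
      rw [foldShifted, if_neg] at hvu
      · rw [← hvu]
      -- No vertex lies strictly below the shifted diagonal, so folding changes nothing and
      -- simultaneous vertices keep distinct ordinates.
      · have : s - 2 * p ≤ m - 1 + 2 * parallelNorth i m s := by rw [parallelNorth]; omega
        simp only; omega
    have e1 := hfold p u h1
    have e2 := hfold q u h2
    exact hpq (Subtype.ext (by omega))

theorem le_or_eq_of_doublyDisjointFinset_nonempty (hi : 2 * i + 3 ≤ 3 * m)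
    (h : (doublyDisjointFinset i m).Nonempty) :
    2 * hNumber i m ≤ m ∨ 2 * i + 3 = 3 * m := by
  obtain ⟨P, hP⟩ := h
  obtain ⟨hP, hn⟩ := (mem_doublyDisjointFinset hi).1 hP
  by_contra! hcon
  obtain ⟨h1, h2⟩ := hcon
  -- One step after the last source, every path is still running because `2i + 3 < 3m`. The time is
  -- odd since there are fewer odd heights than even ones when `m` is odd.
  have hex : ∀ p : Idx i m, ∃ v, (P p)[2 * (i / 2) + 1 - 2 * (p : ℕ)]? = some v := fun p => by
    have hp := p.bounds
    have hq := (revIdx i m p).bounds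
    exact (hP p).exists_getElem?_eq_some (by omega) (by omega)
  choose v hv using hex
  have hodd : ∀ p, foldedHeight m (v p) % 2 = 1 := fun p => by
    have hp := p.bounds
    have := (hP p).fst_add_snd_eq_time (by omega) (hv p)
    rw [foldedHeight_emod_two, this]
    omega
  have hnonneg : ∀ p, 0 ≤ foldedHeight m (v p) := fun p => (hP p).foldedHeight_nonneg (hv p)
  let f : Idx i m → Fin (m / 2) := fun p => ⟨((foldedHeight m (v p) - 1) / 2).toNat, by
    have := hodd p
    have := hnonneg p
    have := foldedHeight_le m (v p)
    omega⟩
  obtain ⟨p, q, hpq, hf⟩ := Fintype.exists_ne_map_eq_of_card_lt f (by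
    rw [card_idx, Fintype.card_fin]; omega)
  have hp := p.bounds
  have hq := q.bounds
  refine hn p q hpq (2 * (i / 2) + 1)
    (meets_of_foldedHeight_eq (hP p) (hP q) (by omega) (by omega) (hv p) (hv q) ?_)
  have hf := Fin.val_eq_of_eq hf
  simp only [f] at hf
  have := hodd p
  have := hodd q
  have := hnonneg p
  have := hnonneg q
  omega

end Systems

theorem theoremD (i m : ℕ) (hi : (i : ℤ) ≤ 3 * ((m : ℤ) - 1) / 2) :
    (doublyVertexDisjointSystems i m).Finite ∧
    (pathCountMatrix i m).det =
      (-1 : ℚ) ^ (hNumber i m / 2) * ((doublyVertexDisjointSystems i m).ncard : ℚ) ∧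
    ((pathCountMatrix i m).det ≠ 0 ↔
      2 * hNumber i m ≤ m ∨ 2 * (i : ℤ) = 3 * ((m : ℤ) - 1)) := by
  have hi' := two_mul_add_three_le hi
  have hdet := det_pathCountMatrix hi'
  rw [doublyVertexDisjointSystems_eq hi', Set.ncard_coe_finset]
  refine ⟨Finset.finite_toSet _, hdet, ?_⟩
  have hne : (pathCountMatrix i m).det ≠ 0 ↔ (doublyDisjointFinset i m).Nonempty := by
    rw [hdet, ← Finset.card_ne_zero]
    simp
  have hcast : 2 * (i : ℤ) = 3 * ((m : ℤ) - 1) ↔ 2 * i + 3 = 3 * m := by omega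
  rw [hne, hcast]
  exact ⟨le_or_eq_of_doublyDisjointFinset_nonempty hi', doublyDisjointFinset_nonempty hi'⟩
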